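/- Let $n\ge 0$ be an integer and equip Euclidean spaces with their Euclidean norms $\|\cdot\|$. A map $w$ defined on a subset of $\mathbb{R}^n$ is called $1$-Lipschitz if $\|w(x)-w(y)\|\le\|x-y\|$ for all $x,y$ in its domain. For a set $S\subset\mathbb{R}^m$ let $\overline{\mathrm{Conv}}\,S$ denote the closed convex hull of $S$. Let $m\ge 2$ and let $v\colon\mathbb{R}^n\to\mathbb{R}^m$ be any map. The following three conditions are equivalent: (i) for every nonempty $A\subset\mathbb{R}^n$ and every $1$-Lipschitz map $u\colon A\to\mathbb{R}^m$ there is a $1$-Lipschitz map $\tilde u\colon\mathbb{R}^n\to\mathbb{R}^m$ with $\tilde u|_A=u$ such that for all $x\in\mathbb{R}^n$ $$v(x)-\tilde u(x)\in\overline{\mathrm{Conv}}\,\{v(z)-u(z) : z\in A\};$$ (ii) for every $\delta>0$, every $A\subset\mathbb{R}^n$ and every $1$-Lipschitz map $u\colon A\to\mathbb{R}^m$ with $\|v(z)-u(z)\|\le\delta$ for all $z\in A$, there is a $1$-Lipschitz map $\tilde u\colon\mathbb{R}^n\to\mathbb{R}^m$ with $\tilde u|_A=u$ such that $\|v(x)-\tilde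 u(x)\|\le\delta$ for all $x\in\mathbb{R}^n$; (iii) $v$ is affine and $1$-Lipschitz. In contrast, for $m=1$ every $1$-Lipschitz function $v\colon\mathbb{R}^n\to\mathbb{R}$ has property (ii) (with $\mathbb{R}$ in place of $\mathbb{R}^m$). -/

import Mathlib

/-- Every `1`-Lipschitz map `u` on a nonempty set `A` extends to a `1`-Lipschitz map `u'` on the
whole space such that `v - u'` takes values in the closed convex hull of `{v z - u z | z ∈ A}`. -/
def HasConvexHullExtension {E F : Type*} [NormedAddCommGroup E]
    [NormedAddCommGroup F] [NormedSpace ℝ F] (v : E → F) : Prop :=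
  ∀ (A : Set E), A.Nonempty → ∀ u : A → F, LipschitzWith 1 u →
    ∃ u' : E → F, LipschitzWith 1 u' ∧ (∀ z : A, u' z = u z) ∧
      ∀ x : E, v x - u' x ∈ closedConvexHull ℝ (Set.range fun z : A => v z - u z)

/-- Every `1`-Lipschitz map `u` on a set `A` at uniform distance at most `δ > 0` from `v` on `A`
extends to a `1`-Lipschitz map on the whole space at uniform distance at most `δ` from `v`. -/
def HasDistancePreservingExtension {E F : Type*} [NormedAddCommGroup E]
    [NormedAddCommGroup F] (v : E → F) : Prop :=
  ∀ δ : ℝ, 0 < δ → ∀ (A : Set E) (u : A → F), LipschitzWith 1 u →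
    (∀ z : A, ‖v z - u z‖ ≤ δ) →
    ∃ u' : E → F, LipschitzWith 1 u' ∧ (∀ z : A, u' z = u z) ∧ ∀ x : E, ‖v x - u' x‖ ≤ δ

/-!
Let `v` be affine and `1`-Lipschitz. To extend `u` from `A` to one more point `x`, we look for `k`
in the closed convex hull of `{v z - u z | z ∈ A}` with `‖u z - (v x - k)‖ ≤ ‖z - x‖` for all
`z ∈ A`. For finite `A`, a minimax theorem reduces this to finding, for given weights `l`, some `k`
satisfying the `l`-weighted sum of the squared inequalities. The weighted mean of `v z - u z` does:
splitting each side into a variance and a squared distance to the barycentre, the variances are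
compared by `u` being `1`-Lipschitz and, as `v` commutes with barycentres, the distances by `v`
being `1`-Lipschitz. Weak compactness of balls handles infinite `A`, and Zorn's lemma yields an
extension to the whole space.

Conversely, assume the distance preserving property and let `w` be the midpoint defect
`v (midpoint ℝ a b) - midpoint ℝ (v a) (v b)`. In dimension at least two there is `e ⟂ w` such that,
for every `c`, the points `v a - (c • w - e)` and `v b - (c • w + e)` are at distance exactly
`‖a - b‖`. A `1`-Lipschitz map with these values at `a` and `b` sends the midpoint of `a` and `b` to
their midpoint, which is at distance `(1 + c) * ‖w‖` from `v (midpoint ℝ a b)`. Hence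
`(1 + c) ^ 2 * ‖w‖ ^ 2 ≤ c ^ 2 * ‖w‖ ^ 2 + ‖e‖ ^ 2` for all `c > 0`, so `w = 0`.

For real-valued `v`, truncating any `1`-Lipschitz extension of `u` between `v - δ` and `v + δ`
preserves both the Lipschitz constant and the values on `A`.
-/

open Metric

section Minimax

variable {V ι : Type*} [AddCommGroup V] [Module ℝ V] [Fintype ι] {C : Set V} {f : ι → V → ℝ}

theorem convexOn_sum_mul (hC : Convex ℝ C) (hf : ∀ i, ConvexOn ℝ C (f i)) {l : ι → ℝ}
    (hl : ∀ i, 0 ≤ l i) : ConvexOn ℝ C fun x => ∑ i, l i * f i x := by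
  have hsum : ConvexOn ℝ C (∑ i, l i • f i) :=
    Finset.sum_induction _ (ConvexOn ℝ C) (fun _ _ => ConvexOn.add) (convexOn_const 0 hC)
      fun i _ => (hf i).smul (hl i)
  simpa [Finset.sum_fn] using hsum

theorem exists_forall_nonpos_of_forall_stdSimplex [TopologicalSpace V] [IsTopologicalAddGroup V]
    [ContinuousSMul ℝ V] [Nonempty ι] (hC : Convex ℝ C) (hCc : IsCompact C)
    (hf : ∀ i, ConvexOn ℝ C (f i)) (hfc : ∀ i, ContinuousOn (f i) C)
    (h : ∀ l ∈ stdSimplex ℝ ι, ∃ x ∈ C, ∑ i, l i * f i x ≤ 0) :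
    ∃ x ∈ C, ∀ i, f i x ≤ 0 := by
  classical
  have hvertex : ∀ i : ι, Pi.single i 1 ∈ stdSimplex ℝ ι := single_mem_stdSimplex ℝ
  obtain ⟨c, hc, -⟩ := h _ (hvertex (Classical.arbitrary ι))
  obtain ⟨x, hx, l, hl, hsaddle⟩ : ∃ x ∈ C, ∃ l ∈ stdSimplex ℝ ι,
      IsSaddlePointOn C (stdSimplex ℝ ι) (fun x l => ∑ i, l i * f i x) x l := by
    refine Sion.exists_isSaddlePointOn ⟨c, hc⟩ hC hCc (fun l _ => ?_) (fun l hl => ?_)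
      (convex_stdSimplex ℝ ι) ⟨_, hvertex (Classical.arbitrary ι)⟩ (isCompact_stdSimplex ℝ ι)
      (fun x _ => ?_) (fun x _ => ?_)
    · exact ContinuousOn.lowerSemicontinuousOn (by fun_prop)
    · exact (convexOn_sum_mul hC hf hl.1).quasiconvexOn
    · exact (Continuous.continuousOn (by fun_prop)).upperSemicontinuousOn
    · exact ((Fintype.linearCombination ℝ fun i => f i x).concaveOn
        (convex_stdSimplex ℝ ι)).quasiconcaveOn
  obtain ⟨y, hy, hy0⟩ := h l hl
  refine ⟨x, hx, fun i => ?_⟩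
  simpa [Pi.single_apply] using (hsaddle y hy _ (hvertex i)).trans hy0

end Minimax

section WeakCompactness

theorem isCompact_toWeakSpace_image_closedBall (𝕜 : Type*) {H : Type*} [RCLike 𝕜]
    [NormedAddCommGroup H] [InnerProductSpace 𝕜 H] [CompleteSpace H] (x : H) (r : ℝ) :
    IsCompact (toWeakSpace 𝕜 H '' closedBall x r) := by
  let riesz := InnerProductSpace.toDual 𝕜 H
  let ψ : WeakDual 𝕜 H → WeakSpace 𝕜 H := fun φ =>
    toWeakSpace 𝕜 H (riesz.symm (WeakDual.toStrongDual φ))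
  have hψ : Continuous ψ := WeakBilin.continuous_of_continuous_eval _ fun f => by
    have heval : ∀ φ : WeakDual 𝕜 H, f (riesz.symm (WeakDual.toStrongDual φ)) =
        starRingEnd 𝕜 (φ (riesz.symm f)) := fun φ => by
      rw [← InnerProductSpace.toDual_symm_apply, ← inner_conj_symm,
        InnerProductSpace.toDual_symm_apply]
      rfl
    exact (RCLike.continuous_conj.comp (WeakDual.eval_continuous (riesz.symm f))).congr
      fun φ => (heval φ).symm
  have himage : toWeakSpace 𝕜 H '' closedBall x r =
      ψ '' (WeakDual.toStrongDual ⁻¹' closedBall (riesz x) r) := by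
    ext y
    constructor
    · rintro ⟨y, hy, rfl⟩
      exact ⟨StrongDual.toWeakDual (riesz y), by simpa using hy, by simp [ψ]⟩
    · rintro ⟨φ, hφ, rfl⟩
      refine ⟨_, ?_, rfl⟩
      rw [mem_closedBall, ← riesz.dist_map]
      simpa using hφ
  exact himage ▸ (WeakDual.isCompact_closedBall _ _).image hψ

theorem inter_iInter_nonempty_of_convex {H ι : Type*} [NormedAddCommGroup H]
    [InnerProductSpace ℝ H] [CompleteSpace H] {x : H} {r : ℝ} {C : ι → Set H}
    (hC : ∀ i, Convex ℝ (C i)) (hCc : ∀ i, IsClosed (C i))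
    (hfin : ∀ s : Finset ι, (closedBall x r ∩ ⋂ i ∈ s, C i).Nonempty) :
    (closedBall x r ∩ ⋂ i, C i).Nonempty := by
  let e := toWeakSpace ℝ H
  have hcompact : IsCompact (e '' closedBall x r) := isCompact_toWeakSpace_image_closedBall ℝ x r
  have hclosed : ∀ i, IsClosed (e '' C i) := fun i => by
    rw [← (hCc i).closure_eq, (hC i).toWeakSpace_closure ℝ]
    exact isClosed_closure
  have hne := hcompact.inter_iInter_nonempty (fun i => e '' C i) hclosed fun s => by
    simpa only [← Set.image_iInter₂ e.bijective, ← Set.image_inter e.injective,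
      Set.image_nonempty] using hfin s
  simpa only [← Set.image_iInter e.bijective, ← Set.image_inter e.injective,
    Set.image_nonempty] using hne

end WeakCompactness

section FiniteKirszbraun

variable {E F ι : Type*} [NormedAddCommGroup E] [InnerProductSpace ℝ E] [NormedAddCommGroup F]
  [InnerProductSpace ℝ F] [Fintype ι]

theorem sum_mul_norm_sub_sq {l : ι → ℝ} (hl : ∑ i, l i = 1) (u : ι → F) (w : F) :
    ∑ i, l i * ‖u i - w‖ ^ 2 =
      (∑ i, ∑ j, l i * l j * ‖u i - u j‖ ^ 2) / 2 + ‖∑ i, l i • u i - w‖ ^ 2 := by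
  -- The family `u` together with `w` of weight `-1` has total weight zero.
  let l' : Option ι → ℝ := fun o => o.elim (-1) l
  let u' : Option ι → F := fun o => o.elim w u
  have hl' : ∑ o, l' o = 0 := by simp [l', Fintype.sum_option, hl]
  have hinner := inner_sum_smul_sum_smul_of_sum_eq_zero u' hl' u' hl'
  simp only [l', u', Fintype.sum_option, Option.elim_none, Option.elim_some, neg_smul, one_smul,
    neg_mul, mul_neg, one_mul, mul_one, neg_add_eq_sub, sub_self, norm_zero, ne_eq,
    OfNat.ofNat_ne_zero, not_false_eq_true, zero_pow, norm_sub_rev w, ← sq,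
    real_inner_self_eq_norm_sq, Finset.sum_sub_distrib, Finset.sum_neg_distrib] at hinner
  linarith

theorem sum_mul_norm_sub_sq_le {l : ι → ℝ} (hl : l ∈ stdSimplex ℝ ι) {u : ι → F} {z : ι → E}
    (hu : ∀ i j, ‖u i - u j‖ ≤ ‖z i - z j‖) {w : F} {x : E}
    (hw : ‖∑ i, l i • u i - w‖ ≤ ‖∑ i, l i • z i - x‖) :
    ∑ i, l i * ‖u i - w‖ ^ 2 ≤ ∑ i, l i * ‖z i - x‖ ^ 2 := by
  have hl0 : ∀ i, 0 ≤ l i := hl.1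
  rw [sum_mul_norm_sub_sq hl.2, sum_mul_norm_sub_sq hl.2]
  gcongr with i _ j _
  · exact mul_nonneg (hl0 i) (hl0 j)
  · exact hu i j

theorem affineMap_sum_smul {V W : Type*} [AddCommGroup V] [Module ℝ V] [AddCommGroup W]
    [Module ℝ W] (v : V →ᵃ[ℝ] W) {l : ι → ℝ} (hl : ∑ i, l i = 1) (z : ι → V) :
    v (∑ i, l i • z i) = ∑ i, l i • v (z i) := by
  simpa only [Finset.univ.affineCombination_eq_linear_combination _ _ hl, Function.comp_apply]
    using Finset.univ.map_affineCombination z l hl v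

theorem exists_mem_convexHull_forall_norm_sub_le {ι : Type*} [Finite ι] [Nonempty ι]
    {v : E →ᵃ[ℝ] F} (hv : LipschitzWith 1 v) {u : ι → F} {z : ι → E}
    (hu : ∀ i j, ‖u i - u j‖ ≤ ‖z i - z j‖) (x : E) :
    ∃ k ∈ convexHull ℝ (Set.range fun i => v (z i) - u i), ∀ i, ‖u i - (v x - k)‖ ≤ ‖z i - x‖ := by
  have := Fintype.ofFinite ι
  let C := convexHull ℝ (Set.range fun i => v (z i) - u i)
  have hC : Convex ℝ C := convex_convexHull ℝ _
  let f : ι → F → ℝ := fun i k => ‖u i - (v x - k)‖ ^ 2 - ‖z i - x‖ ^ 2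
  have hf : ∀ i, ConvexOn ℝ C (f i) := fun i => by
    have hdist : ConvexOn ℝ C fun k => ‖u i - (v x - k)‖ := by
      convert convexOn_dist (v x - u i) hC using 2 with k
      rw [dist_eq_norm]
      congr 1
      abel
    exact (hdist.pow (fun _ _ => norm_nonneg _) 2).sub (concaveOn_const _ hC)
  have hweighted : ∀ l ∈ stdSimplex ℝ ι, ∃ k ∈ C, ∑ i, l i * f i k ≤ 0 := fun l hl => by
    refine ⟨∑ i, l i • (v (z i) - u i), hC.sum_mem (fun i _ => hl.1 i) hl.2
      fun i _ => subset_convexHull ℝ _ ⟨i, rfl⟩, ?_⟩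
    have hle := sum_mul_norm_sub_sq_le hl hu (w := v x - ∑ i, l i • (v (z i) - u i)) (x := x) (by
      have hrw : ∑ i, l i • u i - (v x - ∑ i, l i • (v (z i) - u i)) =
          v (∑ i, l i • z i) - v x := by
        simp only [affineMap_sum_smul v hl.2, smul_sub, Finset.sum_sub_distrib]
        abel
      simpa [hrw, dist_eq_norm] using hv.dist_le_mul (∑ i, l i • z i) x)
    simpa only [f, mul_sub, Finset.sum_sub_distrib, sub_nonpos] using hle
  obtain ⟨k, hk, hkf⟩ := exists_forall_nonpos_of_forall_stdSimplex hC
    ((Set.finite_range _).isCompact_convexHull (𝕜 := ℝ)) hf (fun i => by fun_prop) hweighted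
  exact ⟨k, hk, fun i => le_of_sq_le_sq (sub_nonpos.1 (hkf i)) (norm_nonneg _)⟩

end FiniteKirszbraun

section LipschitzRel

variable {X Y : Type*} [PseudoEMetricSpace X] [PseudoEMetricSpace Y] {K : NNReal}

/-- A relation between the points of `X` and those of `Y`, given as a subset of `X × Y`, is
`K`-Lipschitz if any two related pairs satisfy the `K`-Lipschitz estimate. If `Y` is separated,
such relations are the graphs of the `K`-Lipschitz maps from subsets of `X` to `Y`; extending a map
amounts to enlarging its graph, so maximal extensions come from Zorn's lemma for inclusion. -/
def IsLipschitzRel (K : NNReal) (S : Set (X × Y)) : Prop :=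
  ∀ p ∈ S, ∀ q ∈ S, edist p.2 q.2 ≤ K * edist p.1 q.1

theorem isLipschitzRel_range_iff {A : Set X} {u : A → Y} :
    IsLipschitzRel K (Set.range fun z : A => ((z : X), u z)) ↔ LipschitzWith K u := by
  simp only [IsLipschitzRel, Set.forall_mem_range]
  rfl

theorem IsLipschitzRel.insert {S : Set (X × Y)} (hS : IsLipschitzRel K S) {x : X} {y : Y}
    (hxy : ∀ p ∈ S, edist p.2 y ≤ K * edist p.1 x) : IsLipschitzRel K (insert (x, y) S) := by
  rintro p (rfl | hp) q (rfl | hq)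
  · simp
  · simpa only [edist_comm] using hxy q hq
  · exact hxy p hp
  · exact hS p hp q hq

theorem IsLipschitzRel.sUnion {c : Set (Set (X × Y))} (hc : ∀ S ∈ c, IsLipschitzRel K S)
    (hchain : IsChain (· ⊆ ·) c) : IsLipschitzRel K (⋃₀ c) := by
  rintro p ⟨S, hS, hp⟩ q ⟨T, hT, hq⟩
  rcases hchain.total hS hT with hST | hTS
  · exact hc T hT p (hST hp) q hq
  · exact hc S hS p hp q (hTS hq)

theorem exists_lipschitzWith_extension_of_forall_insert {X Y : Type*} [PseudoEMetricSpace X]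
    [EMetricSpace Y] {K : NNReal} {R : Set (X × Y)}
    (hstep : ∀ S ⊆ R, S.Nonempty → IsLipschitzRel K S →
      ∀ x, ∃ y, (x, y) ∈ R ∧ ∀ p ∈ S, edist p.2 y ≤ K * edist p.1 x)
    {A : Set X} (hA : A.Nonempty) {u : A → Y} (hu : LipschitzWith K u)
    (huR : ∀ z : A, ((z : X), u z) ∈ R) :
    ∃ u' : X → Y, LipschitzWith K u' ∧ (∀ z : A, u' z = u z) ∧ ∀ x, (x, u' x) ∈ R := by
  let graph : Set (X × Y) := Set.range fun z : A => ((z : X), u z)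
  obtain ⟨M, hgraph, hM⟩ := zorn_subset_nonempty {S | S ⊆ R ∧ IsLipschitzRel K S}
    (fun c hc hchain _ => ⟨⋃₀ c,
      ⟨Set.sUnion_subset fun S hS => (hc hS).1, .sUnion (fun S hS => (hc hS).2) hchain⟩,
      fun S hS => Set.subset_sUnion_of_mem hS⟩)
    graph ⟨Set.range_subset_iff.2 huR, isLipschitzRel_range_iff.2 hu⟩
  obtain ⟨hMR, hMlip⟩ := hM.prop
  have hMne : M.Nonempty := ⟨_, hgraph ⟨⟨_, hA.some_mem⟩, rfl⟩⟩
  have htotal : ∀ x, ∃ y, (x, y) ∈ M := fun x => by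
    obtain ⟨y, hyR, hy⟩ := hstep M hMR hMne hMlip x
    exact ⟨y, hM.le_of_ge ⟨Set.insert_subset hyR hMR, hMlip.insert hy⟩
      (Set.subset_insert _ _) (Set.mem_insert _ _)⟩
  choose u' hu' using htotal
  refine ⟨u', fun x y => hMlip _ (hu' x) _ (hu' y), fun z => ?_, fun x => hMR (hu' x)⟩
  have hz := hMlip _ (hu' z) _ (hgraph ⟨z, rfl⟩)
  simpa using hz

end LipschitzRel

section ConvexHullExtension

variable {E F ι : Type*} [NormedAddCommGroup E] [InnerProductSpace ℝ E] [NormedAddCommGroup F]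
  [InnerProductSpace ℝ F] [CompleteSpace F] {v : E →ᵃ[ℝ] F}

theorem exists_sub_mem_forall_norm_sub_le [Nonempty ι] (hv : LipschitzWith 1 v) {K : Set F}
    (hK : Convex ℝ K) (hKc : IsClosed K) {u : ι → F} {z : ι → E}
    (hu : ∀ i j, ‖u i - u j‖ ≤ ‖z i - z j‖) (huK : ∀ i, v (z i) - u i ∈ K) (x : E) :
    ∃ y, v x - y ∈ K ∧ ∀ i, ‖u i - y‖ ≤ ‖z i - x‖ := by
  classical
  let i₀ : ι := Classical.arbitrary ι
  let C : ι → Set F := fun i => {y | v x - y ∈ K} ∩ closedBall (u i) ‖z i - x‖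
  have hCconv : ∀ i, Convex ℝ (C i) := fun i =>
    (hK.affine_preimage (AffineMap.const ℝ F (v x) - AffineMap.id ℝ F)).inter
      (convex_closedBall _ _)
  have hCclosed : ∀ i, IsClosed (C i) := fun i =>
    (hKc.preimage (by fun_prop)).inter isClosed_closedBall
  obtain ⟨y, -, hy⟩ := inter_iInter_nonempty_of_convex (x := u i₀) (r := ‖z i₀ - x‖)
    hCconv hCclosed fun s => by
      let t := insert i₀ s
      have : Nonempty t := ⟨⟨i₀, Finset.mem_insert_self _ _⟩⟩
      obtain ⟨k, hk, hball⟩ := exists_mem_convexHull_forall_norm_sub_le hv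
        (u := fun i : t => u i) (z := fun i : t => z i) (fun i j => hu i j) x
      have hkK : k ∈ K :=
        convexHull_min (Set.range_subset_iff.2 fun i : t => huK i) hK hk
      have hmem : ∀ i ∈ t, v x - k ∈ closedBall (u i) ‖z i - x‖ := fun i hi =>
        mem_closedBall_iff_norm'.2 (hball ⟨i, hi⟩)
      exact ⟨v x - k, hmem i₀ (Finset.mem_insert_self _ _), Set.mem_iInter₂.2 fun i hi =>
        ⟨by simpa using hkK, hmem i (Finset.mem_insert_of_mem hi)⟩⟩
  rw [Set.mem_iInter] at hy
  exact ⟨y, (hy i₀).1, fun i => mem_closedBall_iff_norm'.1 (hy i).2⟩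

theorem hasConvexHullExtension_of_lipschitzWith (hv : LipschitzWith 1 v) :
    HasConvexHullExtension v := by
  intro A hA u hu
  let K := closedConvexHull ℝ (Set.range fun z : A => v z - u z)
  refine exists_lipschitzWith_extension_of_forall_insert (R := {p | v p.1 - p.2 ∈ K})
    (fun S hSR hS hSlip x => ?_) hA hu fun z => subset_closedConvexHull ⟨z, rfl⟩
  have : Nonempty S := hS.to_subtype
  have hSnorm : ∀ p q : S, ‖p.1.2 - q.1.2‖ ≤ ‖p.1.1 - q.1.1‖ := fun p q => by
    simpa [edist_eq_enorm_sub, enorm_le_iff_norm_le] using hSlip p p.2 q q.2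
  obtain ⟨y, hyK, hy⟩ := exists_sub_mem_forall_norm_sub_le hv convex_closedConvexHull
    isClosed_closedConvexHull hSnorm (fun p => hSR p.2) x
  exact ⟨y, hyK, fun p hp => by
    simpa [edist_eq_enorm_sub, enorm_le_iff_norm_le] using hy ⟨p, hp⟩⟩

end ConvexHullExtension

section DistancePreserving

theorem lipschitzWith_of_forall_pos_exists_dist_le {X Y : Type*} [PseudoMetricSpace X]
    [PseudoMetricSpace Y] {K : NNReal} {v : X → Y}
    (h : ∀ ε > 0, ∃ w : X → Y, LipschitzWith K w ∧ ∀ x, dist (v x) (w x) ≤ ε) :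
    LipschitzWith K v := by
  refine LipschitzWith.of_dist_le_mul fun x y => le_of_forall_pos_le_add fun ε hε => ?_
  obtain ⟨w, hw, hvw⟩ := h (ε / 2) (half_pos hε)
  calc dist (v x) (v y)
      ≤ dist (v x) (w x) + dist (w x) (w y) + dist (w y) (v y) := dist_triangle4 ..
    _ ≤ ε / 2 + K * dist x y + ε / 2 := by
        gcongr
        · exact hvw x
        · exact hw.dist_le_mul x y
        · exact dist_comm (v y) (w y) ▸ hvw y
    _ = K * dist x y + ε := by ring

section

variable {E F : Type*} [NormedAddCommGroup E] [NormedAddCommGroup F] [NormedSpace ℝ F] {v : E → F}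

theorem HasConvexHullExtension.lipschitzWith (h : HasConvexHullExtension v) :
    LipschitzWith 1 v := by
  obtain ⟨u', hu', -, hvu'⟩ := h {0} (Set.singleton_nonempty 0) (fun z => v z)
    fun x y => by simp [Subsingleton.elim x y]
  have hsubset : closedConvexHull ℝ (Set.range fun z : ({0} : Set E) => v z - v z) ⊆ {0} :=
    closedConvexHull_min (by rintro _ ⟨z, rfl⟩; simp) (convex_singleton 0) isClosed_singleton
  have heq : v = u' := funext fun x => sub_eq_zero.1 (hsubset (hvu' x))
  exact heq ▸ hu'

theorem HasConvexHullExtension.hasDistancePreservingExtension (h : HasConvexHullExtension v) :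
    HasDistancePreservingExtension v := by
  intro δ hδ A u hu hvu
  rcases A.eq_empty_or_nonempty with rfl | hA
  · exact ⟨v, h.lipschitzWith, fun z => z.2.elim, fun x => by simpa using hδ.le⟩
  obtain ⟨u', hu', hext, hvu'⟩ := h A hA u hu
  have hsubset : closedConvexHull ℝ (Set.range fun z : A => v z - u z) ⊆ closedBall 0 δ :=
    closedConvexHull_min (Set.range_subset_iff.2 fun z => mem_closedBall_zero_iff.2 (hvu z))
      (convex_closedBall 0 δ) isClosed_closedBall
  exact ⟨u', hu', hext, fun x => mem_closedBall_zero_iff.1 (hsubset (hvu' x))⟩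

end

theorem HasDistancePreservingExtension.lipschitzWith {E F : Type*} [NormedAddCommGroup E]
    [NormedAddCommGroup F] {v : E → F} (h : HasDistancePreservingExtension v) :
    LipschitzWith 1 v :=
  lipschitzWith_of_forall_pos_exists_dist_le fun ε hε => by
    obtain ⟨w, hw, -, hvw⟩ := h ε hε ∅ (fun z => z.2.elim) (fun z => z.2.elim) fun z => z.2.elim
    exact ⟨w, hw, fun x => (dist_eq_norm _ _).trans_le (hvw x)⟩

end DistancePreserving

section Midpoint

theorem map_midpoint_of_dist_eq {E F : Type*} [NormedAddCommGroup E] [NormedSpace ℝ E]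
    [NormedAddCommGroup F] [NormedSpace ℝ F] [StrictConvexSpace ℝ F] {w : E → F}
    (hw : LipschitzWith 1 w) {a b : E} (hab : dist (w a) (w b) = dist a b) :
    w (midpoint ℝ a b) = midpoint ℝ (w a) (w b) := by
  have hleft := hw.dist_le_mul a (midpoint ℝ a b)
  have hright := hw.dist_le_mul (midpoint ℝ a b) b
  have htriangle := dist_triangle (w a) (w (midpoint ℝ a b)) (w b)
  simp only [dist_left_midpoint, dist_midpoint_right, NNReal.coe_one, one_mul,
    Real.norm_ofNat] at hleft hright
  refine eq_midpoint_of_dist_eq_half ?_ ?_ <;> linarith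

theorem HasDistancePreservingExtension.exists_of_dist_eq {E F : Type*} [NormedAddCommGroup E]
    [NormedAddCommGroup F] {v : E → F} (h : HasDistancePreservingExtension v) {a b : E} {p q : F}
    (hpq : dist p q = dist a b) {δ : ℝ} (hδ : 0 < δ) (hp : ‖v a - p‖ ≤ δ) (hq : ‖v b - q‖ ≤ δ) :
    ∃ u' : E → F, LipschitzWith 1 u' ∧ u' a = p ∧ u' b = q ∧ ∀ x, ‖v x - u' x‖ ≤ δ := by
  classical
  let g : E → F := fun x => if x = a then p else q
  have hga : g a = p := if_pos rfl
  have hgb : g b = q := by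
    by_cases hab : b = a
    · rw [hab, hga, ← dist_eq_zero, hpq, hab, dist_self]
    · exact if_neg hab
  have hdist : ∀ x ∈ ({a, b} : Set E), ∀ y ∈ ({a, b} : Set E), dist (g x) (g y) ≤ dist x y := by
    simp [hga, hgb, hpq, dist_comm q, dist_comm b]
  have hglip : LipschitzWith 1 fun z : ({a, b} : Set E) => g z :=
    LipschitzWith.of_dist_le_mul fun x y => by
      simpa [Subtype.dist_eq] using hdist x x.2 y y.2
  obtain ⟨u', hu', hext, hvu'⟩ := h δ hδ {a, b} (fun z => g z) hglip (by simp [hga, hgb, hp, hq])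
  exact ⟨u', hu', (hext ⟨a, by simp⟩).trans hga, (hext ⟨b, by simp⟩).trans hgb, hvu'⟩

theorem HasDistancePreservingExtension.norm_map_midpoint_sub_midpoint_le {E F : Type*}
    [NormedAddCommGroup E] [NormedSpace ℝ E] [NormedAddCommGroup F] [NormedSpace ℝ F]
    [StrictConvexSpace ℝ F] {v : E → F} (h : HasDistancePreservingExtension v) {a b : E} {p q : F}
    (hpq : dist p q = dist a b) {δ : ℝ} (hδ : 0 < δ) (hp : ‖v a - p‖ ≤ δ) (hq : ‖v b - q‖ ≤ δ) :
    ‖v (midpoint ℝ a b) - midpoint ℝ p q‖ ≤ δ := by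
  obtain ⟨u', hu', rfl, rfl, hvu'⟩ := h.exists_of_dist_eq hpq hδ hp hq
  exact map_midpoint_of_dist_eq hu' hpq ▸ hvu' (midpoint ℝ a b)

theorem exists_mem_norm_add_eq {F : Type*} [NormedAddCommGroup F] [NormedSpace ℝ F]
    (S : Submodule ℝ F) [Nontrivial S] {p : F} {r : ℝ} (hp : ‖p‖ ≤ r) : ∃ s ∈ S, ‖p + s‖ = r := by
  have hr : 0 ≤ r := (norm_nonneg p).trans hp
  obtain ⟨s, hs⟩ := exists_norm_eq S (c := r + ‖p‖) (by positivity)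
  have hlarge : r ≤ ‖p + s‖ := by
    have := norm_sub_le_norm_add (s : F) p
    rw [add_comm p]
    rw [Submodule.coe_norm] at hs
    linarith
  obtain ⟨t, ht⟩ := mem_range_of_exists_le_of_exists_ge
    (f := fun t : S => ‖p + t‖) (by fun_prop) ⟨0, by simpa using hp⟩ ⟨s, hlarge⟩
  exact ⟨t, t.2, ht⟩

variable {E F : Type*} [NormedAddCommGroup E] [NormedSpace ℝ E] [NormedAddCommGroup F]
  [InnerProductSpace ℝ F] {v : E → F}

theorem nontrivial_orthogonal_span_singleton (hF : 1 < Module.rank ℝ F) (w : F) :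
    Nontrivial (ℝ ∙ w)ᗮ := by
  rw [Submodule.nontrivial_iff_ne_bot]
  intro hbot
  have htop : (ℝ ∙ w) = ⊤ := Submodule.orthogonal_eq_bot_iff.1 hbot
  have hle : Module.rank ℝ (ℝ ∙ w) ≤ 1 := by simpa using rank_span_le (R := ℝ) {w}
  rw [htop, rank_top] at hle
  exact hF.not_ge hle

theorem HasDistancePreservingExtension.mul_norm_map_midpoint_sub_midpoint_sq_le
    (h : HasDistancePreservingExtension v) {a b : E} {e : F}
    (he : inner ℝ (v (midpoint ℝ a b) - midpoint ℝ (v a) (v b)) e = 0)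
    (hab : ‖v a - v b + (2 : ℝ) • e‖ = dist a b) {c : ℝ} (hc : 0 < c) :
    (1 + 2 * c) * ‖v (midpoint ℝ a b) - midpoint ℝ (v a) (v b)‖ ^ 2 ≤ ‖e‖ ^ 2 := by
  set w := v (midpoint ℝ a b) - midpoint ℝ (v a) (v b) with hw
  rcases eq_or_ne w 0 with hw0 | hw0
  · simp [hw0]
  have hcwe : inner ℝ (c • w) e = 0 := by rw [real_inner_smul_left, he, mul_zero]
  have hpythagoras : ‖c • w + e‖ ^ 2 = c ^ 2 * ‖w‖ ^ 2 + ‖e‖ ^ 2 := by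
    rw [sq, norm_add_sq_eq_norm_sq_add_norm_sq_real hcwe, norm_smul, Real.norm_of_nonneg hc.le]
    ring
  have hpos : 0 < ‖c • w + e‖ :=
    (norm_nonneg _).lt_of_ne' (sq_pos_iff.1 (by rw [hpythagoras]; positivity))
  have hsymm : ‖c • w - e‖ = ‖c • w + e‖ := norm_sub_eq_norm_add (by rwa [real_inner_comm])
  have hle := h.norm_map_midpoint_sub_midpoint_le (a := a) (b := b)
    (p := v a - (c • w - e)) (q := v b - (c • w + e))
    (by rw [← hab, dist_eq_norm]; congr 1; module) hpos (by simp [hsymm]) (by simp)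
  have hdiff : v (midpoint ℝ a b) - midpoint ℝ (v a - (c • w - e)) (v b - (c • w + e)) =
      (1 + c) • w := by
    simp only [midpoint_eq_smul_add, invOf_eq_inv] at hw ⊢
    rw [add_smul, one_smul]
    nth_rw 3 [hw]
    module
  rw [hdiff] at hle
  have hsq := pow_le_pow_left₀ (norm_nonneg _) hle 2
  rw [hpythagoras, norm_smul, Real.norm_of_nonneg (by positivity)] at hsq
  linarith

theorem HasDistancePreservingExtension.map_midpoint (hF : 1 < Module.rank ℝ F)
    (h : HasDistancePreservingExtension v) (a b : E) :
    v (midpoint ℝ a b) = midpoint ℝ (v a) (v b) := by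
  by_contra hne
  set w := v (midpoint ℝ a b) - midpoint ℝ (v a) (v b)
  have hw0 : w ≠ 0 := sub_ne_zero.2 hne
  have := nontrivial_orthogonal_span_singleton hF w
  obtain ⟨s, hsw, hs⟩ := exists_mem_norm_add_eq (ℝ ∙ w)ᗮ (p := v a - v b) (r := dist a b) (by
    simpa [dist_eq_norm] using h.lipschitzWith.dist_le_mul a b)
  have he : inner ℝ w ((2⁻¹ : ℝ) • s) = 0 := by
    rw [real_inner_smul_right, Submodule.mem_orthogonal_singleton_iff_inner_right.1 hsw, mul_zero]
  have hle := h.mul_norm_map_midpoint_sub_midpoint_sq_le he (by simpa using hs)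
    (c := ‖(2⁻¹ : ℝ) • s‖ ^ 2 / ‖w‖ ^ 2 + 1) (by positivity)
  have hw2 : 0 < ‖w‖ ^ 2 := by positivity
  have := div_mul_cancel₀ (‖(2⁻¹ : ℝ) • s‖ ^ 2) hw2.ne'
  nlinarith [sq_nonneg ‖(2⁻¹ : ℝ) • s‖]

end Midpoint

section RealValued

theorem exists_lipschitzWith_extension_real {X : Type*} [PseudoMetricSpace X] {K : NNReal}
    {A : Set X} {u : A → ℝ} (hu : LipschitzWith K u) :
    ∃ g : X → ℝ, LipschitzWith K g ∧ ∀ z : A, g z = u z := by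
  have hu₀ : LipschitzOnWith K (Function.extend Subtype.val u 0) A := by
    rwa [lipschitzOnWith_iff_restrict, Set.domRestrict_eq,
      Function.extend_comp Subtype.val_injective]
  obtain ⟨g, hg, hgu⟩ := hu₀.extend_real
  exact ⟨g, hg, fun z => by rw [← hgu z.2, Subtype.val_injective.extend_apply]⟩

theorem hasDistancePreservingExtension_of_lipschitzWith_real {E : Type*} [NormedAddCommGroup E]
    {v : E → ℝ} (hv : LipschitzWith 1 v) : HasDistancePreservingExtension v := by
  intro δ hδ A u hu hvu
  obtain ⟨g, hg, hgu⟩ := exists_lipschitzWith_extension_real hu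
  have hshift : ∀ c : ℝ, LipschitzWith 1 fun x => v x + c := fun c => by
    simpa using hv.add (LipschitzWith.const c)
  refine ⟨fun x => max (v x + -δ) (min (v x + δ) (g x)), ?_, fun z => ?_, fun x => ?_⟩
  · simpa using (hshift (-δ)).max ((hshift δ).min hg)
  · have := abs_le.1 (hvu z)
    simp only [hgu]
    rw [min_eq_right (by linarith), max_eq_right (by linarith)]
  · have hlower := le_max_left (v x + -δ) (min (v x + δ) (g x))
    have hupper : max (v x + -δ) (min (v x + δ) (g x)) ≤ v x + δ :=
      max_le (by linarith) (min_le_left _ _)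
    rw [Real.norm_eq_abs, abs_le]
    constructor <;> linarith

end RealValued

theorem mainTheorem1_general {E F : Type*} [NormedAddCommGroup E] [InnerProductSpace ℝ E]
    [NormedAddCommGroup F] [InnerProductSpace ℝ F] [CompleteSpace F] (hF : 1 < Module.rank ℝ F)
    (v : E → F) :
    List.TFAE [
      HasConvexHullExtension v,
      HasDistancePreservingExtension v,
      (∃ f : E →ᵃ[ℝ] F, ⇑f = v) ∧ LipschitzWith 1 v] := by
  tfae_have 1 → 2 := HasConvexHullExtension.hasDistancePreservingExtension
  tfae_have 2 → 3 := fun h => ⟨⟨AffineMap.ofMapMidpoint v (h.map_midpoint hF)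
    h.lipschitzWith.continuous, rfl⟩, h.lipschitzWith⟩
  tfae_have 3 → 1 := by
    rintro ⟨⟨f, rfl⟩, hf⟩
    exact hasConvexHullExtension_of_lipschitzWith hf
  tfae_finish

theorem mainTheorem1 (n : ℕ) :
    (∀ m : ℕ, 2 ≤ m → ∀ v : EuclideanSpace ℝ (Fin n) → EuclideanSpace ℝ (Fin m),
      List.TFAE [
        HasConvexHullExtension v,
        HasDistancePreservingExtension v,
        (∃ f : EuclideanSpace ℝ (Fin n) →ᵃ[ℝ] EuclideanSpace ℝ (Fin m), ⇑f = v) ∧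
          LipschitzWith 1 v]) ∧
    (∀ v : EuclideanSpace ℝ (Fin n) → ℝ, LipschitzWith 1 v →
      HasDistancePreservingExtension v) :=
  ⟨fun _ hm => mainTheorem1_general <| Module.one_lt_rank_of_one_lt_finrank <| by
      simpa using Nat.lt_of_succ_le hm,
    fun _ => hasDistancePreservingExtension_of_lipschitzWith_real⟩
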